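/- Let $T$ be the $3x+1$ map on the positive integers, $T(m)=m/2$ if $m$ is even and $T(m)=(3m+1)/2$ if $m$ is odd, and let $T^k$ denote its $k$-th iterate. For a positive integer $m$ and $k\ge 0$ put $p(m)_k=0$ if $T^k(m)$ is even and $p(m)_k=1$ if $T^k(m)$ is odd, and $$r_k(m)=\sum_{i=0}^{k-1}\frac{p(m)_i}{3^{\sum_{j=0}^{i}p(m)_j}\,2^{k-i}}.$$ Let $\varepsilon>0$. Then: (1) The set of all positive integers $m$ such that $$\left(\tfrac{\sqrt3}{2}\right)^k m^{1-\varepsilon}\le T^k(m)\le \left(\tfrac{\sqrt3}{2}\right)^k m^{1+\varepsilon}\qquad\text{for all integers } 0\le k\le \frac{\log_2 m}{1-\log_2\sqrt3}$$ has natural density $1$, i.e. if $A$ is this set, then $\liminf_{N\to\infty}\frac1N\#(A\cap\{1,\dots,N\})=1$. (2) More strongly, the set $S$ of all positive integers $m$ such that, for all integers $0\le k\le \frac{\log_2 m}{1-\log_2\sqrt3}$, $$\left(\tfrac{\sqrt3}{2}\right)^k m^{1-\varepsilon}\le T^k(m)\le \left(\tfrac{\sqrt3}{2}\right)^k m^{1+\varepsilon}\quad\text{and}\quad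 r_k(m)\,3^{k/2}\,m^{-\varepsilon}<1$$ has polynomially fast density $1$: there are constants $C>0$ and $0<D\le 1$ such that $\frac1N\#(S\cap\{1,\dots,N\})\ge 1-\frac{C}{N^{D}}$ for every integer $N\ge 1$. -/

import Mathlib

namespace ThreeXPlusOne

/-- The `3x+1` map: `T m = m / 2` for even `m` and `T m = (3 m + 1) / 2` for odd `m` (both divisions
are exact). It is used on positive integers, which it maps to positive integers. -/
def T (m : ℕ) : ℕ := if Even m then m / 2 else (3 * m + 1) / 2

/-- The parity sequence: `0` if the `k`-th iterate `T^k(m)` is even and `1` if it is odd. -/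
def parity (m k : ℕ) : ℕ := if Even (T^[k] m) then 0 else 1

/-- The remainder
`r_k(m) = ∑_{0 ≤ i < k} p(m)_i / (3 ^ (∑_{0 ≤ j ≤ i} p(m)_j) * 2 ^ (k - i))`. -/
noncomputable def remainder (k m : ℕ) : ℝ :=
  ∑ i ∈ Finset.range k,
    (parity m i : ℝ) / ((3 : ℝ) ^ (∑ j ∈ Finset.range (i + 1), parity m j) * (2 : ℝ) ^ (k - i))

/-- The proportion of the elements of `{1, …, N}` that lie in `S`. -/
noncomputable def proportion (S : Set ℕ) (N : ℕ) : ℝ :=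
  ((S ∩ Set.Icc 1 N).ncard : ℝ) / (N : ℝ)

/-- `S` has natural density `1`. The sequence lies in `[0, 1]`, so the real `liminf` is genuine. -/
def HasNaturalDensityOne (S : Set ℕ) : Prop :=
  Filter.liminf (fun N : ℕ => proportion S N) Filter.atTop = 1

/-- `S` has polynomially fast density `1`: for some `C > 0` and `0 < D ≤ 1`, the proportion of
`{1, …, N}` that lies in `S` is at least `1 - C / N ^ D` for every `N ≥ 1`. -/
def HasPolynomiallyFastDensityOne (S : Set ℕ) : Prop :=
  ∃ C D : ℝ, 0 < C ∧ 0 < D ∧ D ≤ 1 ∧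
    ∀ N : ℕ, 0 < N → 1 - C / (N : ℝ) ^ D ≤ proportion S N

end ThreeXPlusOne

/-!
Let `s` be the number of odd terms among `m, …, T^(k-1)(m)`. Then
`T^k(m) = 3 ^ s * (m / 2 ^ k + r_k(m))`, and if `s` stays within `δ * log m` of half the number of
steps, then all three estimates hold with a loss `m ^ O(δ)` (`Balanced.remainder_mul_le`,
`Balanced.iterate_bounds`). So it suffices that for all but `O(N ^ (1 - D))` of the integers
`m ≤ N` the parity sequence is balanced in this sense up to the critical time
`log₂ m / (1 - log₂ √3)`, at which the predicted size `(√3 / 2) ^ k * m` reaches `1`.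

The first `k` parities run through all binary words of length `k` as `m` runs through the residues
modulo `2 ^ k`, so a Chernoff bound (`card_deviation_range_le`) handles about `log₂ m` steps. To go
further, suppose balance is known up to time `t`. If balance fails in the next `u` steps, where
`2 ^ u` is at most the predicted size `2 ^ n * (√3 / 2) ^ t` of `y = T^t(m)`, then `y` lies in an
exceptional set of exponentially small proportion among the integers of that size. What remains is
to see that the distribution of `T^t(m)` is not concentrated on a few values: each `y` has at most
`(2 / √3) ^ t` balanced preimages, up to a small power of `N`, which is the number expected on
average (`card_fiber_le`).

This follows by splitting the `t` steps into the first `j` and the last `b = t - j`, with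
`2 ^ b` slightly below `3 ^ (t / 2)`. The affine formula
`2 ^ t * y = 3 ^ s * m + (3 ^ s_b * R_j + 2 ^ j * R_b)` determines `R_b` modulo `3 ^ s` from `y`, `s`
and the residue of `m` modulo `2 ^ j`, and balance gives `R_b < 3 ^ s`. Hence `m` is determined by
that residue and `s`, which leaves `2 ^ j * (t + 1)` possibilities (`eq_of_iterate_eq`).

A small power of `N` is lost in each extension, governed by the error `δ₁` allowed up to time `t`; it
is compensated by taking `δ₁` of order `δ ^ 2` (`TypicallyBalanced.add`). Since finitely many
extensions of length proportional to `log N` reach any fixed fraction of the critical time, and the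
last few steps change the count of odd terms only a little, the exponent `D` stays positive.
-/

namespace ThreeXPlusOne

/-! ### Affine form of the iterates -/

/-- The number of odd terms among `m, T m, …, T^(k-1) m`. -/
def oddCount (k m : ℕ) : ℕ := ∑ i ∈ Finset.range k, parity m i

/-- The constant term of the affine formula `2 ^ k * T^k(m) = 3 ^ (oddCount k m) * m + shift k m`. -/
def shift : ℕ → ℕ → ℕ
  | 0, _ => 0
  | k + 1, m => 3 ^ parity m k * shift k m + parity m k * 2 ^ k

theorem oddCount_zero (m : ℕ) : oddCount 0 m = 0 := rfl

theorem oddCount_succ (k m : ℕ) : oddCount (k + 1) m = oddCount k m + parity m k :=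
  Finset.sum_range_succ _ _

theorem parity_eq_mod (m k : ℕ) : parity m k = T^[k] m % 2 := by
  unfold parity
  split_ifs with h
  · exact (Nat.even_iff.mp h).symm
  · exact (Nat.not_even_iff.mp h).symm

theorem parity_le_one (m k : ℕ) : parity m k ≤ 1 := by
  rw [parity_eq_mod]; omega

theorem parity_add (m a i : ℕ) : parity m (a + i) = parity (T^[a] m) i := by
  rw [parity_eq_mod, parity_eq_mod, Nat.add_comm, Function.iterate_add_apply]

theorem oddCount_add (a b m : ℕ) :
    oddCount (a + b) m = oddCount a m + oddCount b (T^[a] m) := by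
  unfold oddCount
  rw [Finset.sum_range_add]
  simp only [parity_add]

theorem oddCount_le (k m : ℕ) : oddCount k m ≤ k := by
  induction k with
  | zero => simp [oddCount_zero]
  | succ k ih => rw [oddCount_succ]; have := parity_le_one m k; omega

theorem two_mul_T (x : ℕ) : 2 * T x = 3 ^ (x % 2) * x + x % 2 := by
  unfold T
  rcases Nat.mod_two_eq_zero_or_one x with h | h
  · rw [if_pos (Nat.even_iff.mpr h), h]; omega
  · rw [if_neg (Nat.not_even_iff.mpr h), h]; omega

theorem two_pow_mul_iterate (k m : ℕ) :
    2 ^ k * T^[k] m = 3 ^ oddCount k m * m + shift k m := by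
  induction k with
  | zero => simp [oddCount_zero, shift]
  | succ k ih =>
    have h := two_mul_T (T^[k] m)
    rw [← parity_eq_mod] at h
    rw [Function.iterate_succ_apply', oddCount_succ, shift]
    calc 2 ^ (k + 1) * T (T^[k] m) = 2 ^ k * (2 * T (T^[k] m)) := by ring
      _ = 3 ^ parity m k * (2 ^ k * T^[k] m) + parity m k * 2 ^ k := by rw [h]; ring
      _ = _ := by rw [ih]; ring

theorem T_add_two_mul (x w : ℕ) : T (x + 2 * w) = T x + 3 ^ (x % 2) * w := by
  have h1 := two_mul_T x
  have h2 := two_mul_T (x + 2 * w)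
  have h3 : (x + 2 * w) % 2 = x % 2 := by omega
  rw [h3] at h2
  have : 2 * T (x + 2 * w) = 2 * (T x + 3 ^ (x % 2) * w) := by rw [h2, mul_add 2, h1]; ring
  omega

/-- Translating `m` by a multiple of `2 ^ k` does not change its first `k` parities. -/
theorem iterate_add_two_pow_mul (k m q : ℕ) :
    T^[k] (m + 2 ^ k * q) = T^[k] m + 3 ^ oddCount k m * q ∧
      oddCount k (m + 2 ^ k * q) = oddCount k m := by
  induction k generalizing q with
  | zero => simp [oddCount_zero]
  | succ k ih =>
    obtain ⟨h1, h2⟩ := ih (2 * q)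
    rw [← mul_assoc, ← pow_succ] at h1 h2
    have h3 : T^[k] (m + 2 ^ (k + 1) * q) = T^[k] m + 2 * (3 ^ oddCount k m * q) := by
      rw [h1]; ring
    have hp : parity (m + 2 ^ (k + 1) * q) k = parity m k := by
      rw [parity_eq_mod, parity_eq_mod, h3]; omega
    refine ⟨?_, by rw [oddCount_succ, oddCount_succ, h2, hp]⟩
    rw [Function.iterate_succ_apply', Function.iterate_succ_apply', h3, T_add_two_mul,
      ← parity_eq_mod, oddCount_succ]
    ring

theorem shift_add_two_pow_mul (k m q : ℕ) : shift k (m + 2 ^ k * q) = shift k m := by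
  have h := two_pow_mul_iterate k (m + 2 ^ k * q)
  rw [(iterate_add_two_pow_mul k m q).1, (iterate_add_two_pow_mul k m q).2, mul_add,
    two_pow_mul_iterate k m] at h
  linarith [h]

theorem oddCount_mod (k m : ℕ) : oddCount k (m % 2 ^ k) = oddCount k m := by
  conv_rhs => rw [← Nat.mod_add_div m (2 ^ k)]
  exact (iterate_add_two_pow_mul k _ _).2.symm

theorem shift_mod (k m : ℕ) : shift k (m % 2 ^ k) = shift k m := by
  conv_rhs => rw [← Nat.mod_add_div m (2 ^ k)]
  exact (shift_add_two_pow_mul k _ _).symm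

theorem remainder_succ (k m : ℕ) : remainder (k + 1) m =
    remainder k m / 2 + parity m k / (3 ^ oddCount (k + 1) m * 2) := by
  unfold remainder
  rw [Finset.sum_range_succ, Finset.sum_div]
  congr 1
  · refine Finset.sum_congr rfl fun i hi => ?_
    rw [Finset.mem_range] at hi
    rw [show k + 1 - i = (k - i) + 1 by omega, pow_succ, ← mul_assoc, div_div]
  · rw [show k + 1 - k = 1 by omega, pow_one]; rfl

theorem shift_eq_remainder (k m : ℕ) :
    (shift k m : ℝ) = remainder k m * 3 ^ oddCount k m * 2 ^ k := by
  induction k with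
  | zero => simp [shift, remainder]
  | succ k ih =>
    rw [shift, remainder_succ, oddCount_succ]
    push_cast
    rw [ih]
    field_simp
    ring

theorem iterate_eq_remainder (k m : ℕ) :
    (T^[k] m : ℝ) = 3 ^ oddCount k m * (m / 2 ^ k + remainder k m) := by
  have h : (2 : ℝ) ^ k * T^[k] m = 3 ^ oddCount k m * m + shift k m := by
    exact_mod_cast two_pow_mul_iterate k m
  rw [shift_eq_remainder] at h
  field_simp
  linarith

/-! ### Balanced parity sequences -/

/-- `Balanced a k m`: each of the first `k` initial segments of the parity sequence of `m` has as
many odd as even terms, up to an error of `a` in the count of odd terms. -/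
def Balanced (a : ℝ) (k m : ℕ) : Prop :=
  ∀ i ≤ k, |(oddCount i m : ℝ) - i / 2| ≤ a

theorem Balanced.mono {a b : ℝ} {k l m : ℕ} (h : Balanced a l m) (hab : a ≤ b) (hkl : k ≤ l) :
    Balanced b k m := fun i hi => (h i (hi.trans hkl)).trans hab

theorem Balanced.iterate {a : ℝ} {j k m : ℕ} (h : Balanced a (j + k) m) :
    Balanced (2 * a) k (T^[j] m) := by
  intro i hi
  have h1 := abs_le.mp (h j (by omega))
  have h2 := abs_le.mp (h (j + i) (by omega))
  rw [oddCount_add] at h2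
  push_cast at h2
  rw [abs_le]
  constructor <;> linarith [h1.1, h1.2, h2.1, h2.2]

theorem remainder_nonneg (k m : ℕ) : 0 ≤ remainder k m :=
  Finset.sum_nonneg fun _ _ => by positivity

theorem sqrt_three_pow (k : ℕ) : Real.sqrt 3 ^ k = (3 : ℝ) ^ ((k : ℝ) / 2) := by
  rw [Real.sqrt_eq_rpow, ← Real.rpow_natCast, ← Real.rpow_mul (by norm_num)]
  congr 1; ring

theorem sqrt_three_div_two_lt_one : Real.sqrt 3 / 2 < 1 := by
  rw [div_lt_one (by norm_num), Real.sqrt_lt' (by norm_num)]; norm_num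

/-- The bound `4 * 3 ^ a` is preserved by the recursion for `remainder`, as
`4 * (√3 / 2) + 1 / 2 ≤ 4`. -/
theorem Balanced.remainder_mul_le {a : ℝ} {k m : ℕ} (h : Balanced a k m) :
    remainder k m * Real.sqrt 3 ^ k ≤ 4 * 3 ^ a := by
  induction k with
  | zero => simp [remainder]; positivity
  | succ k ih =>
    have ih := ih (h.mono le_rfl (Nat.le_succ k))
    have hs : Real.sqrt 3 ≤ 7 / 4 := by
      rw [Real.sqrt_le_left (by norm_num)]; norm_num
    have hp : (parity m k : ℝ) ≤ 1 := by exact_mod_cast parity_le_one m k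
    have h1 := (abs_le.mp (h (k + 1) le_rfl)).1
    have h2 : Real.sqrt 3 ^ (k + 1) ≤ 3 ^ a * 3 ^ oddCount (k + 1) m := by
      rw [sqrt_three_pow, ← Real.rpow_natCast 3 (oddCount _ _), ← Real.rpow_add (by norm_num)]
      exact Real.rpow_le_rpow_of_exponent_le (by norm_num) (by linarith)
    have h3 : (parity m k : ℝ) / (3 ^ oddCount (k + 1) m * 2) * Real.sqrt 3 ^ (k + 1) ≤
        3 ^ a / 2 := by
      rw [div_mul_eq_mul_div, div_le_div_iff₀ (by positivity) (by positivity)]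
      calc (parity m k : ℝ) * Real.sqrt 3 ^ (k + 1) * 2
          ≤ 1 * (3 ^ a * 3 ^ oddCount (k + 1) m) * 2 := by gcongr
        _ = _ := by ring
    have h4 : (0 : ℝ) < 3 ^ a := by positivity
    have h5 : 0 ≤ remainder k m * Real.sqrt 3 ^ k :=
      mul_nonneg (remainder_nonneg k m) (by positivity)
    rw [remainder_succ, add_mul]
    calc _ ≤ (remainder k m * Real.sqrt 3 ^ k) * (Real.sqrt 3 / 2) + 3 ^ a / 2 := by
          refine add_le_add (le_of_eq ?_) h3
          ring
      _ ≤ (4 * 3 ^ a) * (7 / 4 / 2) + 3 ^ a / 2 := by gcongr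
      _ = 4 * 3 ^ a := by ring

theorem Balanced.three_pow_le {a : ℝ} {k m : ℕ} (h : Balanced a k m) :
    (3 : ℝ) ^ oddCount k m ≤ Real.sqrt 3 ^ k * 3 ^ a := by
  rw [sqrt_three_pow, ← Real.rpow_natCast 3 (oddCount _ _), ← Real.rpow_add (by norm_num)]
  exact Real.rpow_le_rpow_of_exponent_le (by norm_num) (by linarith [(abs_le.mp (h k le_rfl)).2])

theorem Balanced.le_three_pow {a : ℝ} {k m : ℕ} (h : Balanced a k m) :
    Real.sqrt 3 ^ k ≤ 3 ^ oddCount k m * (3 : ℝ) ^ a := by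
  rw [sqrt_three_pow, ← Real.rpow_natCast 3 (oddCount _ _), ← Real.rpow_add (by norm_num)]
  exact Real.rpow_le_rpow_of_exponent_le (by norm_num) (by linarith [(abs_le.mp (h k le_rfl)).1])

theorem Balanced.iterate_le {a : ℝ} {k m : ℕ} (h : Balanced a k m) :
    (T^[k] m : ℝ) ≤ (Real.sqrt 3 / 2) ^ k * m * 3 ^ a + 4 * 3 ^ (2 * a) := by
  rw [iterate_eq_remainder]
  have h1 := h.three_pow_le
  have h2 := h.remainder_mul_le
  have h3 := remainder_nonneg k m
  calc (3 : ℝ) ^ oddCount k m * (m / 2 ^ k + remainder k m)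
      ≤ (Real.sqrt 3 ^ k * 3 ^ a) * (m / 2 ^ k + remainder k m) := by gcongr
    _ = (Real.sqrt 3 / 2) ^ k * m * 3 ^ a + (remainder k m * Real.sqrt 3 ^ k) * 3 ^ a := by
        rw [div_pow]; ring
    _ ≤ (Real.sqrt 3 / 2) ^ k * m * 3 ^ a + (4 * 3 ^ a) * 3 ^ a := by gcongr
    _ = _ := by rw [two_mul, Real.rpow_add (by norm_num)]; ring

theorem Balanced.le_iterate {a : ℝ} {k m : ℕ} (h : Balanced a k m) :
    (Real.sqrt 3 / 2) ^ k * m ≤ (T^[k] m : ℝ) * 3 ^ a := by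
  rw [iterate_eq_remainder]
  have h1 := h.le_three_pow
  have h3 := remainder_nonneg k m
  calc (Real.sqrt 3 / 2) ^ k * m = Real.sqrt 3 ^ k * (m / 2 ^ k) := by rw [div_pow]; ring
    _ ≤ (3 ^ oddCount k m * (3 : ℝ) ^ a) * (m / 2 ^ k + remainder k m) := by
        gcongr; linarith
    _ = _ := by ring

/-- The constant term contributed by the steps after the `j`-th, when it is small compared with
the power of `3` in the affine formula for all `j + b` steps. -/
theorem Balanced.shift_iterate_lt {a : ℝ} {j b m : ℕ} (h : Balanced a (j + b) m)
    (hj : 4 * 3 ^ (3 * a) * (2 : ℝ) ^ (j + b) < 2 ^ j * Real.sqrt 3 ^ (j + b)) :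
    shift b (T^[j] m) < 3 ^ oddCount (j + b) m := by
  have h1 := h.iterate.remainder_mul_le
  have h2 := (h.mono le_rfl (Nat.le_add_right j b)).le_three_pow
  have hs : (0 : ℝ) < Real.sqrt 3 ^ b := by positivity
  have ha : (3 : ℝ) ^ (3 * a) = 3 ^ (2 * a) * 3 ^ a := by
    rw [← Real.rpow_add (by norm_num)]; congr 1; ring
  have hpa : (0 : ℝ) < 3 ^ a := by positivity
  have hj' : 4 * 3 ^ (2 * a) * (2 : ℝ) ^ b < 3 ^ oddCount j m * Real.sqrt 3 ^ b := by
    rw [ha, pow_add, pow_add] at hj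
    have h6 : (4 * 3 ^ (2 * a) * (2 : ℝ) ^ b) * (2 ^ j * 3 ^ a) <
        (3 ^ oddCount j m * Real.sqrt 3 ^ b) * (2 ^ j * 3 ^ a) := by
      calc (4 * 3 ^ (2 * a) * (2 : ℝ) ^ b) * (2 ^ j * 3 ^ a)
          = 4 * (3 ^ (2 * a) * 3 ^ a) * (2 ^ j * 2 ^ b) := by ring
        _ < 2 ^ j * (Real.sqrt 3 ^ j * Real.sqrt 3 ^ b) := hj
        _ ≤ 2 ^ j * ((3 ^ oddCount j m * (3 : ℝ) ^ a) * Real.sqrt 3 ^ b) := by gcongr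
        _ = _ := by ring
    exact lt_of_mul_lt_mul_right h6 (by positivity)
  have : (shift b (T^[j] m) : ℝ) < 3 ^ oddCount (j + b) m := by
    rw [shift_eq_remainder, oddCount_add, pow_add]
    refine lt_of_mul_lt_mul_right ?_ hs.le
    calc remainder b (T^[j] m) * 3 ^ oddCount b (T^[j] m) * 2 ^ b * Real.sqrt 3 ^ b
        = (remainder b (T^[j] m) * Real.sqrt 3 ^ b) * 2 ^ b * 3 ^ oddCount b (T^[j] m) := by ring
      _ ≤ (4 * 3 ^ (2 * a)) * 2 ^ b * 3 ^ oddCount b (T^[j] m) := by gcongr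
      _ < (3 ^ oddCount j m * Real.sqrt 3 ^ b) * 3 ^ oddCount b (T^[j] m) := by gcongr
      _ = _ := by ring
  exact_mod_cast this

/-! ### Fibres of the iterates -/

/-- A balanced preimage `m` of `y` is determined by its residue modulo `2 ^ j` and by its number of
odd steps `s`: the affine formula fixes the constant term of the last `b` steps modulo `3 ^ s`, and
that term is smaller than `3 ^ s`. -/
theorem eq_of_iterate_eq {j b m m' : ℕ} (hT : T^[j + b] m = T^[j + b] m')
    (hmod : m % 2 ^ j = m' % 2 ^ j) (hs : oddCount (j + b) m = oddCount (j + b) m')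
    (hm : shift b (T^[j] m) < 3 ^ oddCount (j + b) m)
    (hm' : shift b (T^[j] m') < 3 ^ oddCount (j + b) m) : m = m' := by
  have key : ∀ x : ℕ, 2 ^ (j + b) * T^[j + b] x = 3 ^ oddCount (j + b) x * x +
      (3 ^ oddCount b (T^[j] x) * shift j x + 2 ^ j * shift b (T^[j] x)) := by
    intro x
    have h1 := two_pow_mul_iterate b (T^[j] x)
    have h2 := two_pow_mul_iterate j x
    rw [← Function.iterate_add_apply, Nat.add_comm b j] at h1
    rw [oddCount_add]
    calc 2 ^ (j + b) * T^[j + b] x = 2 ^ j * (2 ^ b * T^[j + b] x) := by ring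
      _ = 3 ^ oddCount b (T^[j] x) * (2 ^ j * T^[j] x) + 2 ^ j * shift b (T^[j] x) := by
          rw [h1]; ring
      _ = _ := by rw [h2]; ring
  have hsj : oddCount j m = oddCount j m' := by
    rw [← oddCount_mod, hmod, oddCount_mod]
  have hRj : shift j m = shift j m' := by
    rw [← shift_mod, hmod, shift_mod]
  have hsb : oddCount b (T^[j] m) = oddCount b (T^[j] m') := by
    have := hs
    rw [oddCount_add, oddCount_add] at this; omega
  have k1 := key m
  have k2 := key m'
  rw [hT, k2, ← hs, ← hRj, ← hsb] at k1
  set S := 3 ^ oddCount (j + b) m with hS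
  have k3 : S * m + 2 ^ j * shift b (T^[j] m) = S * m' + 2 ^ j * shift b (T^[j] m') := by
    linarith
  have hcong : shift b (T^[j] m) ≡ shift b (T^[j] m') [MOD S] := by
    have hc : 2 ^ j * shift b (T^[j] m) ≡ 2 ^ j * shift b (T^[j] m') [MOD S] := by
      have : S * m + 2 ^ j * shift b (T^[j] m) ≡
          S * m' + 2 ^ j * shift b (T^[j] m') [MOD S] := by rw [k3]
      simpa [Nat.ModEq, Nat.mul_add_mod] using this
    refine Nat.ModEq.cancel_left_of_coprime ?_ hc
    exact Nat.Coprime.pow _ _ (by norm_num)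
  rw [Nat.ModEq.eq_of_lt_of_lt hcong hm hm'] at k3
  exact Nat.eq_of_mul_eq_mul_left (by positivity : 0 < S) (by omega)

/-- Among the balanced integers at most `2 ^ j * (t + 1)` have a given `t`-th iterate, where `2 ^ j`
is about `(2 / √3) ^ t`. This is the average number of preimages, up to factors `3 ^ O(a)` and `t`. -/
theorem card_fiber_le {a : ℝ} {t j : ℕ} (y : ℕ) (F : Finset ℕ)
    (hF : ∀ m ∈ F, Balanced a t m ∧ T^[t] m = y)
    (hj : 4 * 3 ^ (3 * a) * (2 : ℝ) ^ t < 2 ^ j * Real.sqrt 3 ^ t) :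
    F.card ≤ 2 ^ j * (t + 1) := by
  obtain ⟨i, b, hij, hib, hlt⟩ : ∃ i b : ℕ, i ≤ j ∧ t = i + b ∧
      ∀ m ∈ F, shift b (T^[i] m) < 3 ^ oddCount (i + b) m := by
    rcases le_total t j with h | h
    · exact ⟨t, 0, h, rfl, fun m _ => by simp [shift]⟩
    · obtain ⟨b, rfl⟩ := Nat.exists_eq_add_of_le h
      exact ⟨j, b, le_rfl, rfl, fun m hm => (hF m hm).1.shift_iterate_lt hj⟩
  subst hib
  have hcard : F.card ≤ (Finset.range (2 ^ i) ×ˢ Finset.range (i + b + 1)).card := by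
    refine Finset.card_le_card_of_injOn (fun m => (m % 2 ^ i, oddCount (i + b) m)) ?_ ?_
    · intro m _
      have := oddCount_le (i + b) m
      simp only [Finset.coe_product, Set.mem_prod, Finset.coe_range, Set.mem_Iio]
      exact ⟨Nat.mod_lt _ (by positivity), by omega⟩
    · intro m hm m' hm' h
      rw [Prod.mk.injEq] at h
      refine eq_of_iterate_eq ((hF m hm).2.trans (hF m' hm').2.symm) h.1 h.2 (hlt m hm) ?_
      rw [h.2]; exact hlt m' hm'
  rw [Finset.card_product, Finset.card_range, Finset.card_range] at hcard
  exact hcard.trans (Nat.mul_le_mul_right _ (Nat.pow_le_pow_right (by norm_num) hij))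

/-! ### Large deviations of the number of odd steps -/

/-- The parity sequences of length `k` of the residues modulo `2 ^ k` are all the binary words, so
the number of odd steps is binomially distributed; this is its moment generating function. -/
theorem sum_exp_oddCount (l : ℝ) (k : ℕ) :
    ∑ m ∈ Finset.range (2 ^ k), Real.exp (2 * l * (oddCount k m - k / 2)) =
      (2 * Real.cosh l) ^ k := by
  induction k with
  | zero => simp [oddCount_zero]
  | succ k ih =>
    rw [pow_succ 2 k, mul_two, Finset.sum_range_add, ← Finset.sum_add_distrib, pow_succ, ← ih,
      Finset.sum_mul]
    refine Finset.sum_congr rfl fun m _ => ?_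
    have h := iterate_add_two_pow_mul k m 1
    rw [mul_one, mul_one] at h
    rw [Nat.add_comm (2 ^ k) m, oddCount_succ, oddCount_succ, h.2]
    have hodd : 3 ^ oddCount k m % 2 = 1 := by
      rw [Nat.pow_mod]; simp
    -- exactly one of the two lifts `m` and `m + 2 ^ k` has an odd `k`-th iterate
    have hp : parity m k + parity (m + 2 ^ k) k = 1 := by
      rw [parity_eq_mod, parity_eq_mod, h.1]; omega
    have e0 : ∀ x : ℝ, Real.exp (2 * l * (x + 0 - (k + 1) / 2)) =
        Real.exp (2 * l * (x - k / 2)) * Real.exp (-l) := by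
      intro x; rw [← Real.exp_add]; congr 1; ring
    have e1 : ∀ x : ℝ, Real.exp (2 * l * (x + 1 - (k + 1) / 2)) =
        Real.exp (2 * l * (x - k / 2)) * Real.exp l := by
      intro x; rw [← Real.exp_add]; congr 1; ring
    rw [Real.cosh_eq]
    rcases Nat.le_one_iff_eq_zero_or_eq_one.mp (parity_le_one m k) with h0 | h0
    · have h1 : parity (m + 2 ^ k) k = 1 := by omega
      rw [h0, h1]; push_cast; rw [e0, e1]; ring
    · have h1 : parity (m + 2 ^ k) k = 0 := by omega
      rw [h0, h1]; push_cast; rw [e0, e1]; ring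

open scoped Classical in
theorem card_deviation_range_two_pow_le {l x : ℝ} (hl : 0 ≤ l) (k : ℕ) :
    (((Finset.range (2 ^ k)).filter fun m => x < |(oddCount k m : ℝ) - k / 2|).card : ℝ) ≤
      2 ^ k * (2 * Real.exp (-(2 * l * x) + k * l ^ 2 / 2)) := by
  set F := (Finset.range (2 ^ k)).filter fun m => x < |(oddCount k m : ℝ) - k / 2| with hF
  have h1 : (F.card : ℝ) * Real.exp (2 * l * x) ≤
      ∑ m ∈ Finset.range (2 ^ k), (Real.exp (2 * l * (oddCount k m - k / 2)) +
        Real.exp (2 * (-l) * (oddCount k m - k / 2))) := by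
    rw [← nsmul_eq_mul, ← Finset.sum_const]
    refine (Finset.sum_le_sum fun m hm => ?_).trans (Finset.sum_le_sum_of_subset_of_nonneg
      (Finset.filter_subset _ _) fun m _ _ => by positivity)
    have hm := (Finset.mem_filter.mp hm).2
    rcases lt_abs.mp hm with h | h
    · have : Real.exp (2 * l * x) ≤ Real.exp (2 * l * (oddCount k m - k / 2)) :=
        Real.exp_le_exp.mpr (mul_le_mul_of_nonneg_left h.le (by positivity))
      linarith [Real.exp_pos (2 * (-l) * (oddCount k m - k / 2))]
    · have : Real.exp (2 * l * x) ≤ Real.exp (2 * (-l) * (oddCount k m - k / 2)) := by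
        rw [show 2 * (-l) * ((oddCount k m : ℝ) - k / 2) =
          2 * l * -((oddCount k m : ℝ) - k / 2) by ring]
        exact Real.exp_le_exp.mpr (mul_le_mul_of_nonneg_left h.le (by positivity))
      linarith [Real.exp_pos (2 * l * (oddCount k m - k / 2))]
  rw [Finset.sum_add_distrib, sum_exp_oddCount, sum_exp_oddCount, Real.cosh_neg] at h1
  have h2 : (2 * Real.cosh l) ^ k ≤ 2 ^ k * Real.exp (k * l ^ 2 / 2) := by
    rw [mul_pow]
    gcongr
    calc Real.cosh l ^ k ≤ Real.exp (l ^ 2 / 2) ^ k := by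
          have := (Real.cosh_pos l).le
          gcongr
          exact Real.cosh_le_exp_half_sq l
      _ = _ := by rw [← Real.exp_nat_mul]; congr 1; ring
  rw [Real.exp_add, Real.exp_neg, ← div_eq_inv_mul, ← mul_div_assoc, ← mul_div_assoc,
    le_div_iff₀ (Real.exp_pos _)]
  linarith

open scoped Classical in
theorem card_deviation_range_le {l x : ℝ} (hl : 0 ≤ l) (k M : ℕ) :
    (((Finset.range M).filter fun m => x < |(oddCount k m : ℝ) - k / 2|).card : ℝ) ≤
      (M + 2 ^ k) * (2 * Real.exp (-(2 * l * x) + k * l ^ 2 / 2)) := by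
  have hcard : ((Finset.range M).filter fun m => x < |(oddCount k m : ℝ) - k / 2|).card ≤
      (Finset.range (M / 2 ^ k + 1) ×ˢ
        (Finset.range (2 ^ k)).filter fun m => x < |(oddCount k m : ℝ) - k / 2|).card := by
    refine Finset.card_le_card_of_injOn (fun m => (m / 2 ^ k, m % 2 ^ k)) ?_ ?_
    · intro m hm
      obtain ⟨h1, h2⟩ := Finset.mem_filter.mp hm
      rw [Finset.mem_range] at h1
      simp only [Finset.coe_product, Set.mem_prod, Finset.mem_coe, Finset.mem_range,
        Finset.mem_filter, oddCount_mod]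
      exact ⟨Nat.lt_succ_of_le (Nat.div_le_div_right h1.le),
        Nat.mod_lt _ (by positivity), h2⟩
    · intro m _ m' _ h
      rw [Prod.mk.injEq] at h
      rw [← Nat.mod_add_div m (2 ^ k), ← Nat.mod_add_div m' (2 ^ k), h.1, h.2]
  rw [Finset.card_product, Finset.card_range] at hcard
  have h2 := card_deviation_range_two_pow_le (x := x) hl k
  have h3 : ((M / 2 ^ k : ℕ) : ℝ) ≤ (M : ℝ) / 2 ^ k := by
    have := @Nat.cast_div_le ℝ _ _ _ M (2 ^ k)
    push_cast at this; exact this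
  calc _ ≤ (((M / 2 ^ k : ℕ) : ℝ) + 1) *
        (((Finset.range (2 ^ k)).filter fun m => x < |(oddCount k m : ℝ) - k / 2|).card : ℝ) := by
        exact_mod_cast hcard
    _ ≤ ((M : ℝ) / 2 ^ k + 1) * (2 ^ k * (2 * Real.exp (-(2 * l * x) + k * l ^ 2 / 2))) := by
        gcongr
    _ = _ := by field_simp

/-! ### Extending the time range -/

open scoped Classical in
/-- If `m < 2 ^ n` is balanced up to time `t` but not up to time `t + u`, then `T^t(m)` is one of the
rare integers of its size whose parity sequence is unbalanced within `u` steps; and each of them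
has few balanced preimages. The size `2 ^ n * (√3 / 2) ^ t` of `T^t(m)` and the number
`(2 / √3) ^ t` of preimages have product `2 ^ n`, so that only the factors `3 ^ (δ₁ * n)` are
lost against the large-deviation bound. -/
theorem card_not_balanced_add_le {δ δ₁ : ℝ} {n t u : ℕ} (h0 : 0 ≤ δ₁) (hδ : δ₁ ≤ δ / 2)
    (hu : u ≤ 2 * n) (hsize : (2 : ℝ) ^ u ≤ 2 * (2 ^ n * (Real.sqrt 3 / 2) ^ t))
    (hone : 1 ≤ (2 : ℝ) ^ n * (Real.sqrt 3 / 2) ^ t) :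
    (((Finset.range (2 ^ n)).filter fun m => ¬ Balanced (δ * n) (t + u) m).card : ℝ) ≤
      ((Finset.range (2 ^ n)).filter fun m => ¬ Balanced (δ₁ * n) t m).card +
      128 * (u + 1) * (t + 1) * 3 ^ (5 * (δ₁ * n)) * 2 ^ n * Real.exp (-(δ ^ 2 / 4 * n)) := by
  set a : ℝ := δ₁ * n with ha
  have ha0 : 0 ≤ a := by positivity
  have hδ0 : 0 ≤ δ := by linarith
  set q : ℝ := Real.sqrt 3 / 2 with hq
  have hq0 : 0 < q := by positivity
  have hqt : 0 < q ^ t := by positivity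
  have hq1 : q ≤ 1 := sqrt_three_div_two_lt_one.le
  set W : ℝ := 2 ^ n * q ^ t with hW
  set E : ℝ := Real.exp (-(δ ^ 2 / 4 * n)) with hE
  have h31 : (1 : ℝ) ≤ 3 ^ a := Real.one_le_rpow (by norm_num) ha0
  have h3pow : ∀ r : ℕ, (3 : ℝ) ^ ((r : ℝ) * a) = (3 ^ a) ^ r := by
    intro r; rw [mul_comm, Real.rpow_mul (by norm_num), Real.rpow_natCast]
  have h32 : (3 : ℝ) ^ (2 * a) = (3 ^ a) ^ 2 := by exact_mod_cast h3pow 2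
  have h33 : (3 : ℝ) ^ (3 * a) = (3 ^ a) ^ 3 := by exact_mod_cast h3pow 3
  have h35 : (3 : ℝ) ^ (5 * a) = (3 ^ a) ^ 5 := by exact_mod_cast h3pow 5
  set z : ℝ := 3 ^ a with hz
  -- a bound for the size of `T^t(m)`
  set M : ℕ := ⌊q ^ t * 2 ^ n * z + 4 * z ^ 2⌋₊ + 1 with hM
  have hMle : (M : ℝ) ≤ 6 * z ^ 2 * W := by
    have h1 : (M : ℝ) ≤ q ^ t * 2 ^ n * z + 4 * z ^ 2 + 1 := by
      rw [hM]; push_cast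
      have := Nat.floor_le (show 0 ≤ q ^ t * 2 ^ n * z + 4 * z ^ 2 by positivity)
      linarith
    have h2 : z ≤ z ^ 2 := by nlinarith
    have h3 : z ^ 2 ≤ z ^ 2 * W := le_mul_of_one_le_right (by positivity) hone
    have h4 : 1 ≤ z ^ 2 := by nlinarith
    calc (M : ℝ) ≤ W * z + 4 * z ^ 2 + 1 := by rw [hW]; linarith
      _ ≤ W * z ^ 2 + 4 * (z ^ 2 * W) + z ^ 2 * W := by gcongr; linarith
      _ = _ := by ring
  -- the modulus `2 ^ j` in the bound for the fibres of `T^t`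
  obtain ⟨j, hj1, hj2⟩ : ∃ j : ℕ, 4 * z ^ 3 / q ^ t < 2 ^ j ∧ (2 : ℝ) ^ j ≤ 8 * z ^ 3 / q ^ t := by
    have hX : 1 ≤ 4 * z ^ 3 / q ^ t := by
      rw [le_div_iff₀ hqt, one_mul]
      calc q ^ t ≤ 1 := pow_le_one₀ hq0.le hq1
        _ ≤ 4 * z ^ 3 := by linarith [one_le_pow₀ (n := 3) h31]
    obtain ⟨i, hi1, hi2⟩ := exists_nat_pow_near hX (by norm_num : (1 : ℝ) < 2)
    refine ⟨i + 1, hi2, ?_⟩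
    calc (2 : ℝ) ^ (i + 1) = 2 * 2 ^ i := by ring
      _ ≤ 2 * (4 * z ^ 3 / q ^ t) := by gcongr
      _ = _ := by ring
  have hj : 4 * 3 ^ (3 * a) * (2 : ℝ) ^ t < 2 ^ j * Real.sqrt 3 ^ t := by
    rw [div_lt_iff₀ hqt, hq, div_pow, ← mul_div_assoc, lt_div_iff₀ (by positivity)] at hj1
    rwa [h33]
  -- the exceptional values of `T^t(m)` for the time `i`, and their preimages
  set B : ℕ → Finset ℕ := fun i =>
    (Finset.range M).filter fun y => δ / 2 * n < |(oddCount i y : ℝ) - i / 2| with hB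
  set G : ℕ → Finset ℕ := fun i =>
    (Finset.range (2 ^ n)).filter fun m => Balanced a t m ∧ T^[t] m ∈ B i with hG
  have hBcard : ∀ i ∈ Finset.range (u + 1), ((B i).card : ℝ) ≤ 16 * z ^ 2 * W * E := by
    intro i hi
    have hiu : i ≤ u := Nat.lt_succ_iff.mp (Finset.mem_range.mp hi)
    have h1 := card_deviation_range_le (x := δ / 2 * n) (show 0 ≤ δ / 2 by positivity) i M
    have h2 : (2 : ℝ) ^ i ≤ 2 * W :=
      (pow_le_pow_right₀ (by norm_num) hiu).trans hsize
    have h3 : W ≤ z ^ 2 * W := le_mul_of_one_le_left (by linarith) (one_le_pow₀ h31)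
    have h4 : Real.exp (-(2 * (δ / 2) * (δ / 2 * n)) + i * (δ / 2) ^ 2 / 2) ≤ E := by
      refine Real.exp_le_exp.mpr ?_
      have h5 : (i : ℝ) ≤ 2 * n := by exact_mod_cast hiu.trans hu
      nlinarith [sq_nonneg (δ / 2)]
    calc ((B i).card : ℝ) ≤ (M + 2 ^ i) *
          (2 * Real.exp (-(2 * (δ / 2) * (δ / 2 * n)) + i * (δ / 2) ^ 2 / 2)) := h1
      _ ≤ (6 * z ^ 2 * W + 2 * z ^ 2 * W) * (2 * E) := by gcongr; linarith
      _ = _ := by ring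
  have hGcard : ∀ i ∈ Finset.range (u + 1), ((G i).card : ℝ) ≤
      128 * (t + 1) * z ^ 5 * 2 ^ n * E := by
    intro i hi
    have h1 : (G i).card ≤ 2 ^ j * (t + 1) * (B i).card := by
      refine Finset.card_le_mul_card_image_of_maps_to (f := fun m => T^[t] m)
        (fun m hm => (Finset.mem_filter.mp hm).2.2) _ fun y _ => ?_
      refine card_fiber_le (a := a) y _ (fun m hm => ?_) hj
      obtain ⟨h1, h2⟩ := Finset.mem_filter.mp hm
      exact ⟨(Finset.mem_filter.mp h1).2.1, h2⟩
    calc ((G i).card : ℝ) ≤ 2 ^ j * (t + 1) * (B i).card := by exact_mod_cast h1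
      _ ≤ (8 * z ^ 3 / q ^ t) * (t + 1) * (16 * z ^ 2 * W * E) := by
          gcongr; exact hBcard i hi
      _ = _ := by rw [hW]; field_simp; ring
  have hsub : ((Finset.range (2 ^ n)).filter fun m => ¬ Balanced (δ * n) (t + u) m) ⊆
      ((Finset.range (2 ^ n)).filter fun m => ¬ Balanced a t m) ∪
        (Finset.range (u + 1)).biUnion G := by
    intro m hm
    obtain ⟨hmn, hbad⟩ := Finset.mem_filter.mp hm
    rw [Finset.mem_union]
    by_cases hg : Balanced a t m
    · right
      by_contra hcon
      refine hbad fun k hk => ?_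
      have haδ : a ≤ δ / 2 * n := by rw [ha]; gcongr
      have hδn : 0 ≤ δ / 2 * n := by positivity
      rcases le_total k t with h | h
      · exact (hg k h).trans (by linarith)
      · obtain ⟨i, rfl⟩ := Nat.exists_eq_add_of_le h
        have hyM : T^[t] m < M := by
          rw [hM, Nat.lt_succ_iff]
          refine Nat.le_floor ?_
          have h1 := hg.iterate_le
          rw [h32] at h1
          have h2 : (m : ℝ) ≤ 2 ^ n := by exact_mod_cast (Finset.mem_range.mp hmn).le
          exact h1.trans (by gcongr)
        have hnot : T^[t] m ∉ B i := fun hy => hcon <| Finset.mem_biUnion.mpr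
          ⟨i, Finset.mem_range.mpr (by omega), Finset.mem_filter.mpr ⟨hmn, hg, hy⟩⟩
        have hle : |(oddCount i (T^[t] m) : ℝ) - i / 2| ≤ δ / 2 * n := by
          by_contra h1
          exact hnot (Finset.mem_filter.mpr ⟨Finset.mem_range.mpr hyM, not_le.mp h1⟩)
        have ht := hg t le_rfl
        rw [oddCount_add]
        push_cast
        rw [abs_le] at *
        constructor <;> linarith [hle.1, hle.2, ht.1, ht.2]
    · left; exact Finset.mem_filter.mpr ⟨hmn, hg⟩
  have hcard := (Finset.card_le_card hsub).trans
    ((Finset.card_union_le _ _).trans (Nat.add_le_add_left Finset.card_biUnion_le _))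
  calc _ ≤ (((Finset.range (2 ^ n)).filter fun m => ¬ Balanced a t m).card : ℝ) +
        ∑ i ∈ Finset.range (u + 1), ((G i).card : ℝ) := by exact_mod_cast hcard
    _ ≤ _ := by
        refine add_le_add_right ?_ _
        refine (Finset.sum_le_sum hGcard).trans (le_of_eq ?_)
        rw [Finset.sum_const, Finset.card_range, nsmul_eq_mul, h35]
        push_cast; ring

/-! ### Typical integers are balanced up to the critical time -/

open scoped Classical in
/-- Up to an exponentially small proportion, the integers `m < 2 ^ n` have parity sequences that
stay balanced, with errors at most `δ * n`, for `τ * n` steps. -/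
def TypicallyBalanced (τ : ℝ) : Prop :=
  ∀ δ : ℝ, 0 < δ → ∃ C D : ℝ, 0 < C ∧ 0 < D ∧ ∀ n : ℕ,
    (((Finset.range (2 ^ n)).filter fun m => ¬ Balanced (δ * n) ⌊τ * n⌋₊ m).card : ℝ) ≤
      C * 2 ^ n * Real.exp (-(D * n))

theorem TypicallyBalanced.mono {τ τ' : ℝ} (h : TypicallyBalanced τ) (hτ : τ' ≤ τ) :
    TypicallyBalanced τ' := by
  classical
  intro δ hδ
  obtain ⟨C, D, hC, hD, hb⟩ := h δ hδ
  refine ⟨C, D, hC, hD, fun n => le_trans ?_ (hb n)⟩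
  refine Nat.cast_le.mpr (Finset.card_le_card fun m hm => ?_)
  obtain ⟨h1, h2⟩ := Finset.mem_filter.mp hm
  refine Finset.mem_filter.mpr ⟨h1, fun h3 => h2 (h3.mono le_rfl ?_)⟩
  exact Nat.floor_le_floor (by gcongr)

theorem typicallyBalanced_zero : TypicallyBalanced 0 := by
  classical
  intro δ hδ
  refine ⟨1, 1, one_pos, one_pos, fun n => ?_⟩
  rw [Finset.filter_false_of_mem]
  · simp; positivity
  · intro m _ h
    refine h fun i hi => ?_
    simp only [zero_mul, Nat.floor_zero, Nat.le_zero] at hi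
    subst hi
    simp [oddCount_zero]; positivity

theorem mul_add_one_le_mul_exp {A c x : ℝ} (hA : 0 ≤ A) (hc : 0 < c) (hx : 0 ≤ x) :
    A * x + 1 ≤ (A / c + 1) * Real.exp (c * x) := by
  have h1 := Real.add_one_le_exp (c * x)
  calc A * x + 1 ≤ A * x + 1 + (A / c + c * x) := by
        have : 0 ≤ A / c + c * x := by positivity
        linarith
    _ = (A / c + 1) * (c * x + 1) := by field_simp; ring
    _ ≤ _ := by gcongr

/-- The hypothesis on `β` says that `β * n` steps are no more than the predicted number of binary
digits of `T^k(m)` for `m` near `2 ^ n` and `k = τ * n`. -/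
theorem TypicallyBalanced.add {τ β : ℝ} (h : TypicallyBalanced τ) (hτ : 0 ≤ τ) (hβ : 0 ≤ β)
    (hβ1 : β ≤ 1) (hsize : (2 : ℝ) ^ β ≤ 2 * (Real.sqrt 3 / 2) ^ τ) :
    TypicallyBalanced (τ + β) := by
  classical
  intro δ hδ
  -- `δ₁` is of order `δ ^ 2`, so that the loss `3 ^ (5 * δ₁ * n)` stays below the gain
  -- `exp (δ ^ 2 / 4 * n)`
  set δ₁ : ℝ := min (δ / 2) (δ ^ 2 / 80) with hδ₁
  have hδ₁0 : 0 < δ₁ := lt_min (by positivity) (by positivity)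
  obtain ⟨C, D, hC, hD, hb⟩ := h δ₁ hδ₁0
  set c : ℝ := δ ^ 2 / 32 with hc
  have hc0 : 0 < c := by positivity
  set K : ℝ := 128 * (2 / c + 1) * (τ / c + 1) with hK
  have hK0 : 0 < K := by positivity
  refine ⟨C + K, min D (2 * c), by positivity, lt_min hD (by positivity), fun n => ?_⟩
  set q : ℝ := Real.sqrt 3 / 2 with hq
  have hq0 : 0 < q := by positivity
  have hq1 : q ≤ 1 := sqrt_three_div_two_lt_one.le
  set t : ℕ := ⌊τ * n⌋₊ with ht
  have htle : (t : ℝ) ≤ τ * n := Nat.floor_le (by positivity)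
  obtain ⟨u, hu⟩ : ∃ u, ⌊(τ + β) * n⌋₊ = t + u :=
    Nat.exists_eq_add_of_le (Nat.floor_le_floor (by gcongr; linarith))
  have hu1 : (u : ℝ) ≤ β * n + 1 := by
    have h1 : ((t + u : ℕ) : ℝ) ≤ (τ + β) * n := by rw [← hu]; exact Nat.floor_le (by positivity)
    have h2 := Nat.lt_floor_add_one (τ * n)
    push_cast at h1
    linarith
  have hu2 : u ≤ 2 * n := by
    rcases Nat.eq_zero_or_pos n with h0 | h0
    · subst h0
      simp at hu
      omega
    · have h1 : (1 : ℝ) ≤ n := by exact_mod_cast h0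
      have h2 : (u : ℝ) ≤ 2 * n := by nlinarith
      exact_mod_cast h2
  -- the size of the `t`-th iterate dominates `2 ^ (β * n)`
  have hW : ((2 : ℝ) ^ β) ^ n ≤ 2 ^ n * q ^ t := by
    calc ((2 : ℝ) ^ β) ^ n ≤ (2 * q ^ τ) ^ n := by gcongr
      _ = 2 ^ n * q ^ (τ * n) := by rw [mul_pow, Real.rpow_mul hq0.le, Real.rpow_natCast]
      _ ≤ 2 ^ n * q ^ t := by
          rw [← Real.rpow_natCast q t]
          gcongr 2 ^ n * ?_
          exact Real.rpow_le_rpow_of_exponent_ge hq0 hq1 htle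
  have hone : 1 ≤ (2 : ℝ) ^ n * q ^ t :=
    (one_le_pow₀ (Real.one_le_rpow (by norm_num) hβ)).trans hW
  have h2u : (2 : ℝ) ^ u ≤ 2 * (2 ^ n * q ^ t) := by
    calc (2 : ℝ) ^ u = 2 ^ (u : ℝ) := (Real.rpow_natCast _ _).symm
      _ ≤ 2 ^ (β * n + 1) := Real.rpow_le_rpow_of_exponent_le (by norm_num) hu1
      _ = 2 * (2 ^ β) ^ n := by
          rw [Real.rpow_add (by norm_num), Real.rpow_mul (by norm_num), Real.rpow_natCast,
            Real.rpow_one, mul_comm]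
      _ ≤ _ := by gcongr
  have key := card_not_balanced_add_le hδ₁0.le (min_le_left _ _) hu2 h2u hone
  rw [hu]
  have h3 : (3 : ℝ) ^ (5 * (δ₁ * n)) ≤ Real.exp (4 * c * n) := by
    have hlog : Real.log 3 ≤ 2 := by
      linarith [Real.log_le_sub_one_of_pos (show (0 : ℝ) < 3 by norm_num)]
    rw [Real.rpow_def_of_pos (by norm_num)]
    refine Real.exp_le_exp.mpr ?_
    have h4 : δ₁ ≤ δ ^ 2 / 80 := min_le_right _ _
    calc Real.log 3 * (5 * (δ₁ * n)) ≤ 2 * (5 * (δ ^ 2 / 80 * n)) := by gcongr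
      _ = _ := by rw [hc]; ring
  have h5 : (u : ℝ) + 1 ≤ (2 / c + 1) * Real.exp (c * n) := by
    have h6 : (u : ℝ) ≤ 2 * n := by exact_mod_cast hu2
    exact (add_le_add_left h6 1).trans
      (mul_add_one_le_mul_exp (by norm_num) hc0 (Nat.cast_nonneg n))
  have h6 : (t : ℝ) + 1 ≤ (τ / c + 1) * Real.exp (c * n) :=
    (add_le_add_left htle 1).trans (mul_add_one_le_mul_exp hτ hc0 (Nat.cast_nonneg n))
  have hmain : 128 * (u + 1) * (t + 1) * 3 ^ (5 * (δ₁ * n)) * 2 ^ n *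
      Real.exp (-(δ ^ 2 / 4 * n)) ≤ K * 2 ^ n * Real.exp (-(min D (2 * c) * n)) := by
    calc _ ≤ 128 * ((2 / c + 1) * Real.exp (c * n)) * ((τ / c + 1) * Real.exp (c * n)) *
          Real.exp (4 * c * n) * 2 ^ n * Real.exp (-(δ ^ 2 / 4 * n)) := by gcongr
      _ = K * 2 ^ n * (Real.exp (c * n) * Real.exp (c * n) * Real.exp (4 * c * n) *
          Real.exp (-(δ ^ 2 / 4 * n))) := by rw [hK]; ring
      _ = K * 2 ^ n * Real.exp (-(2 * c * n)) := by
          rw [← Real.exp_add, ← Real.exp_add, ← Real.exp_add]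
          congr 2; rw [hc]; ring
      _ ≤ _ := by gcongr; exact min_le_right _ _
  calc _ ≤ _ := key
    _ ≤ C * 2 ^ n * Real.exp (-(min D (2 * c) * n)) +
        K * 2 ^ n * Real.exp (-(min D (2 * c) * n)) := by
        refine add_le_add ((hb n).trans ?_) hmain
        gcongr; exact min_le_left _ _
    _ = _ := by ring

/-- Every time before the critical one is reached in finitely many steps `β`, chosen small enough
for the size condition to hold at all of them. -/
theorem typicallyBalanced_of_one_lt {τ : ℝ} (h : 1 < 2 * (Real.sqrt 3 / 2) ^ τ) :
    TypicallyBalanced τ := by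
  set q : ℝ := Real.sqrt 3 / 2 with hq
  have hq0 : 0 < q := by positivity
  have hq1 : q ≤ 1 := sqrt_three_div_two_lt_one.le
  set β : ℝ := min 1 (Real.logb 2 (2 * q ^ τ)) with hβ
  have hβ0 : 0 < β := lt_min one_pos (Real.logb_pos (by norm_num) h)
  have hβτ : (2 : ℝ) ^ β ≤ 2 * q ^ τ := by
    calc (2 : ℝ) ^ β ≤ 2 ^ Real.logb 2 (2 * q ^ τ) :=
          Real.rpow_le_rpow_of_exponent_le (by norm_num) (min_le_right _ _)
      _ = _ := Real.rpow_logb (by norm_num) (by norm_num) (by positivity)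
  have step : ∀ j : ℕ, TypicallyBalanced (min (j * β) τ) := by
    intro j
    induction j with
    | zero => exact typicallyBalanced_zero.mono (by simp)
    | succ j ih =>
      rcases le_total (j * β) τ with hj | hj
      · rw [min_eq_left hj] at ih
        refine (ih.add (by positivity) hβ0.le (min_le_left _ _) (hβτ.trans ?_)).mono ?_
        · gcongr 2 * ?_
          exact Real.rpow_le_rpow_of_exponent_ge hq0 hq1 hj
        · push_cast
          exact (min_le_left _ _).trans (by linarith)
      · rw [min_eq_right hj] at ih
        exact ih.mono (min_le_right _ _)
  obtain ⟨j, hj⟩ := exists_nat_ge (τ / β)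
  rw [div_le_iff₀ hβ0] at hj
  simpa [min_eq_right hj] using step j

/-- At the critical time `τ`, where the predicted size of the iterate reaches `1`, the last few
steps are too short to spoil the balance. -/
theorem typicallyBalanced_of_eq_one {τ : ℝ} (hτ : 0 < τ)
    (h : 2 * (Real.sqrt 3 / 2) ^ τ = 1) : TypicallyBalanced τ := by
  classical
  intro δ hδ
  set τ' : ℝ := max 0 (τ - δ / 2) with hτ'
  have hlt : τ' < τ := max_lt hτ (by linarith)
  have hq1 := sqrt_three_div_two_lt_one
  have hrare : TypicallyBalanced τ' := by
    refine typicallyBalanced_of_one_lt ?_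
    rw [← h]
    gcongr 2 * ?_
    exact Real.rpow_lt_rpow_of_exponent_gt (by positivity) hq1 hlt
  obtain ⟨C, D, hC, hD, hb⟩ := hrare (δ / 2) (by positivity)
  refine ⟨C + Real.exp (D * (2 / δ)), D, by positivity, hD, fun n => ?_⟩
  rcases le_total (2 / δ) n with hn | hn
  · rw [div_le_iff₀ hδ] at hn
    refine le_trans (Nat.cast_le.mpr (Finset.card_le_card fun m hm => ?_)) ((hb n).trans ?_)
    · obtain ⟨h1, h2⟩ := Finset.mem_filter.mp hm
      refine Finset.mem_filter.mpr ⟨h1, fun h3 => h2 fun k hk => ?_⟩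
      set t : ℕ := ⌊τ' * n⌋₊ with ht
      rcases le_total k t with hkt | hkt
      · refine (h3 k hkt).trans ?_
        gcongr; linarith
      · obtain ⟨i, rfl⟩ := Nat.exists_eq_add_of_le hkt
        have h4 := h3 t le_rfl
        have h5 : ((t + i : ℕ) : ℝ) ≤ τ * n :=
          (Nat.cast_le.mpr hk).trans (Nat.floor_le (by positivity))
        have h6 := Nat.lt_floor_add_one (τ' * n)
        have h7 : (τ - δ / 2) * n ≤ τ' * n := by gcongr; exact le_max_right _ _
        have h8 : (oddCount i (T^[t] m) : ℝ) ≤ i := by exact_mod_cast oddCount_le _ _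
        have h9 : (0 : ℝ) ≤ oddCount i (T^[t] m) := Nat.cast_nonneg _
        rw [oddCount_add]
        push_cast at h5 ⊢
        rw [abs_le] at *
        constructor <;> linarith [h4.1, h4.2]
    · gcongr
      exact le_add_of_nonneg_right (Real.exp_pos _).le
  · have h1 : (((Finset.range (2 ^ n)).filter
        fun m => ¬ Balanced (δ * n) ⌊τ * n⌋₊ m).card : ℝ) ≤ 2 ^ n := by
      have := Finset.card_filter_le (Finset.range (2 ^ n))
        fun m => ¬ Balanced (δ * n) ⌊τ * n⌋₊ m
      rw [Finset.card_range] at this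
      exact_mod_cast this
    have h2 : 1 ≤ Real.exp (D * (2 / δ)) * Real.exp (-(D * n)) := by
      rw [← Real.exp_add]
      refine Real.one_le_exp ?_
      have : D * n ≤ D * (2 / δ) := by gcongr
      linarith
    calc _ ≤ (2 : ℝ) ^ n * 1 := by rw [mul_one]; exact h1
      _ ≤ 2 ^ n * (Real.exp (D * (2 / δ)) * Real.exp (-(D * n))) := by gcongr
      _ = Real.exp (D * (2 / δ)) * 2 ^ n * Real.exp (-(D * n)) := by ring
      _ ≤ _ := by gcongr; exact le_add_of_nonneg_left hC.le

/-- The critical time, in units of `log₂ m`: the time at which the predicted size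
`(√3 / 2) ^ k * m` of the iterate reaches `1`. -/
noncomputable def criticalTime : ℝ := 1 / (1 - Real.logb 2 (Real.sqrt 3))

theorem one_sub_logb_sqrt_three_pos : 0 < 1 - Real.logb 2 (Real.sqrt 3) := by
  have : Real.logb 2 (Real.sqrt 3) < 1 := by
    rw [Real.logb_lt_iff_lt_rpow (by norm_num) (by positivity), Real.rpow_one,
      Real.sqrt_lt' (by norm_num)]
    norm_num
  linarith

theorem criticalTime_pos : 0 < criticalTime := one_div_pos.mpr one_sub_logb_sqrt_three_pos

theorem sqrt_three_div_two_rpow_criticalTime : (Real.sqrt 3 / 2) ^ criticalTime = 1 / 2 := by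
  have h1 : Real.sqrt 3 / 2 = 2 ^ (-(1 - Real.logb 2 (Real.sqrt 3))) := by
    rw [neg_sub, Real.rpow_sub (by norm_num), Real.rpow_one,
      Real.rpow_logb (by norm_num) (by norm_num) (by positivity)]
  rw [h1, ← Real.rpow_mul (by norm_num), criticalTime, neg_mul,
    mul_one_div_cancel one_sub_logb_sqrt_three_pos.ne', Real.rpow_neg_one]
  norm_num

theorem typicallyBalanced_criticalTime : TypicallyBalanced criticalTime :=
  typicallyBalanced_of_eq_one criticalTime_pos (by
    rw [sqrt_three_div_two_rpow_criticalTime]; norm_num)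

/-! ### Density -/

theorem HasPolynomiallyFastDensityOne.mono {S S' : Set ℕ}
    (h : HasPolynomiallyFastDensityOne S) (hS : S ⊆ S') : HasPolynomiallyFastDensityOne S' := by
  obtain ⟨C, D, hC, hD, hD1, hb⟩ := h
  refine ⟨C, D, hC, hD, hD1, fun N hN => (hb N hN).trans ?_⟩
  unfold proportion
  gcongr
  exact (Set.finite_Icc 1 N).subset Set.inter_subset_right

theorem proportion_le_one (S : Set ℕ) (N : ℕ) : proportion S N ≤ 1 := by
  unfold proportion
  refine div_le_one_of_le₀ ?_ (Nat.cast_nonneg N)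
  have h := Set.ncard_le_ncard (Set.inter_subset_right (s := S)) (Set.finite_Icc 1 N)
  rw [← Finset.coe_Icc, Set.ncard_coe_finset, Nat.card_Icc, Finset.coe_Icc] at h
  exact_mod_cast h

theorem HasPolynomiallyFastDensityOne.hasNaturalDensityOne {S : Set ℕ}
    (h : HasPolynomiallyFastDensityOne S) : HasNaturalDensityOne S := by
  obtain ⟨C, D, -, hD, -, hb⟩ := h
  refine Filter.Tendsto.liminf_eq ?_
  have h1 : Filter.Tendsto (fun N : ℕ => 1 - C / (N : ℝ) ^ D) Filter.atTop (nhds 1) := by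
    have h2 := ((tendsto_rpow_atTop hD).comp tendsto_natCast_atTop_atTop).const_div_atTop C
    simpa using h2.const_sub 1
  refine tendsto_of_tendsto_of_tendsto_of_le_of_le' h1 tendsto_const_nhds ?_
    (Filter.Eventually.of_forall fun N => proportion_le_one S N)
  filter_upwards [Filter.eventually_gt_atTop 0] with N hN using hb N hN

theorem two_pow_half_mul_exp_le (n : ℕ) :
    (2 : ℝ) ^ (n / 2) ≤ 2 ^ n * Real.exp (-(1 / 4 * n)) := by
  rw [Real.exp_neg, ← div_eq_mul_inv, le_div_iff₀ (Real.exp_pos _)]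
  have h1 : Real.exp (1 / 2) ≤ 2 := by
    have := Real.exp_le_exp.mpr (show (1 / 2 : ℝ) ≤ Real.log 2 by linarith [Real.log_two_gt_d9])
    rwa [Real.exp_log (by norm_num)] at this
  have h2 : Real.exp (1 / 4 * n) ≤ 2 ^ (n - n / 2) := by
    calc Real.exp (1 / 4 * n) ≤ Real.exp ((n - n / 2 : ℕ) * (1 / 2)) := by
          refine Real.exp_le_exp.mpr ?_
          have : (n : ℝ) ≤ 2 * ((n - n / 2 : ℕ) : ℝ) := by
            exact_mod_cast (show n ≤ 2 * (n - n / 2) by omega)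
          linarith
      _ = Real.exp (1 / 2) ^ (n - n / 2) := Real.exp_nat_mul _ _
      _ ≤ _ := by gcongr
  calc (2 : ℝ) ^ (n / 2) * Real.exp (1 / 4 * n) ≤ 2 ^ (n / 2) * 2 ^ (n - n / 2) := by gcongr
    _ = 2 ^ n := by rw [← pow_add]; congr 1; omega

/-- For `2 ^ (n - 1) ≤ N < 2 ^ n` the integers `m ≤ N` that are unbalanced, or have `m ^ 2 < 2 ^ n`,
number at most a constant times `2 ^ n * exp (-D * n)`, which is `O(N ^ (1 - D))`. -/
theorem hasPolynomiallyFastDensityOne_of_balanced {S : Set ℕ} {δ : ℝ} (hδ : 0 < δ) (n₀ : ℕ)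
    (h : ∀ n m : ℕ, n₀ ≤ n → m < 2 ^ n → 2 ^ n ≤ m ^ 2 →
      Balanced (δ * n) ⌊criticalTime * n⌋₊ m → m ∈ S) :
    HasPolynomiallyFastDensityOne S := by
  classical
  obtain ⟨C, D₀, hC, hD₀, hb⟩ := typicallyBalanced_criticalTime δ hδ
  set D : ℝ := min D₀ (1 / 4) with hD
  have hD0 : 0 < D := lt_min hD₀ (by norm_num)
  refine ⟨2 * (C + 2) + 2 ^ n₀, D, by positivity, hD0, (min_le_right _ _).trans (by norm_num),
    fun N hN => ?_⟩
  have hN0 : (0 : ℝ) < N := by exact_mod_cast hN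
  have hND : (0 : ℝ) < (N : ℝ) ^ D := by positivity
  set n : ℕ := Nat.log 2 N + 1 with hn
  have hlt : N < 2 ^ n := Nat.lt_pow_succ_log_self (by norm_num) N
  have hle : 2 ^ n ≤ 2 * N := by
    rw [hn, pow_succ, mul_comm]
    exact Nat.mul_le_mul_left 2 (Nat.pow_log_le_self 2 hN.ne')
  rcases lt_or_ge n n₀ with hn0 | hn0
  · -- for small `N` the lower bound is negative
    have h1 : (N : ℝ) ^ D ≤ 2 ^ n₀ := by
      calc (N : ℝ) ^ D ≤ (N : ℝ) ^ (1 : ℝ) :=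
            Real.rpow_le_rpow_of_exponent_le (by exact_mod_cast hN)
              ((min_le_right _ _).trans (by norm_num))
        _ = N := Real.rpow_one _
        _ ≤ 2 ^ n₀ := by
            exact_mod_cast hlt.le.trans (Nat.pow_le_pow_right (by norm_num) hn0.le)
    have h2 : 1 ≤ (2 * (C + 2) + 2 ^ n₀) / (N : ℝ) ^ D := by
      rw [le_div_iff₀ hND]; linarith
    have h3 : 0 ≤ proportion S N := by unfold proportion; positivity
    linarith
  · set G : Finset ℕ := (Finset.Icc 1 N).filter fun m => m ∈ S with hG
    set B : Finset ℕ := (Finset.Icc 1 N).filter fun m => m ∉ S with hB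
    have hGB : G.card + B.card = N := by
      rw [hG, hB, Finset.card_filter_add_card_filter_not, Nat.card_Icc, Nat.add_sub_cancel]
    have hprop : proportion S N = (G.card : ℝ) / N := by
      unfold proportion
      rw [← Set.ncard_coe_finset G]
      congr 3
      rw [hG, Finset.coe_filter]
      ext m
      simp only [Set.mem_inter_iff, Set.mem_Icc, Set.mem_ofPred_eq, Finset.mem_Icc]
      exact and_comm
    have hBsub : B ⊆ Finset.range (2 ^ (n / 2 + 1)) ∪ (Finset.range (2 ^ n)).filter
        fun m => ¬ Balanced (δ * n) ⌊criticalTime * n⌋₊ m := by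
      intro m hm
      obtain ⟨h1, h2⟩ := Finset.mem_filter.mp hm
      have h3 : m < 2 ^ n := (Finset.mem_Icc.mp h1).2.trans_lt hlt
      rw [Finset.mem_union]
      by_cases h4 : m < 2 ^ (n / 2 + 1)
      · left; exact Finset.mem_range.mpr h4
      · right
        refine Finset.mem_filter.mpr ⟨Finset.mem_range.mpr h3, fun h5 => h2 (h n m hn0 h3 ?_ h5)⟩
        calc 2 ^ n ≤ 2 ^ ((n / 2 + 1) * 2) := Nat.pow_le_pow_right (by norm_num) (by omega)
          _ = (2 ^ (n / 2 + 1)) ^ 2 := pow_mul _ _ _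
          _ ≤ m ^ 2 := Nat.pow_le_pow_left (not_lt.mp h4) 2
    have hBcard : (B.card : ℝ) ≤ (C + 2) * 2 ^ n * Real.exp (-(D * n)) := by
      have h1 := (Finset.card_le_card hBsub).trans (Finset.card_union_le _ _)
      rw [Finset.card_range] at h1
      calc (B.card : ℝ) ≤ 2 ^ (n / 2 + 1) + ((Finset.range (2 ^ n)).filter
            fun m => ¬ Balanced (δ * n) ⌊criticalTime * n⌋₊ m).card := by exact_mod_cast h1
        _ ≤ 2 * (2 ^ n * Real.exp (-(D * n))) + C * 2 ^ n * Real.exp (-(D * n)) := by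
            gcongr
            · rw [pow_succ, mul_comm]
              gcongr
              refine (two_pow_half_mul_exp_le n).trans ?_
              gcongr; exact min_le_right _ _
            · refine (hb n).trans ?_
              gcongr; exact min_le_left _ _
        _ = _ := by ring
    have hND' : (N : ℝ) ^ D * Real.exp (-(D * n)) ≤ 1 := by
      rw [Real.exp_neg, ← div_eq_mul_inv, div_le_one (Real.exp_pos _)]
      calc (N : ℝ) ^ D ≤ (Real.exp n) ^ D := by
            gcongr
            calc (N : ℝ) ≤ 2 ^ n := by exact_mod_cast hlt.le
              _ ≤ Real.exp 1 ^ n := by gcongr; linarith [Real.add_one_le_exp (1 : ℝ)]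
              _ = Real.exp n := by rw [← Real.exp_nat_mul, mul_one]
        _ = Real.exp (D * n) := by rw [← Real.exp_mul, mul_comm]
    have hfin : (B.card : ℝ) / N ≤ (2 * (C + 2) + 2 ^ n₀) / (N : ℝ) ^ D := by
      rw [div_le_div_iff₀ hN0 hND]
      calc (B.card : ℝ) * (N : ℝ) ^ D
          ≤ ((C + 2) * 2 ^ n * Real.exp (-(D * n))) * (N : ℝ) ^ D := by gcongr
        _ = (C + 2) * 2 ^ n * ((N : ℝ) ^ D * Real.exp (-(D * n))) := by ring
        _ ≤ (C + 2) * (2 * N) * 1 := by gcongr; exact_mod_cast hle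
        _ ≤ (2 * (C + 2) + 2 ^ n₀) * N := by
            have : (0 : ℝ) ≤ 2 ^ n₀ * N := by positivity
            linarith
    have hGN : (G.card : ℝ) / N = 1 - (B.card : ℝ) / N := by
      have : (G.card : ℝ) + B.card = N := by exact_mod_cast hGB
      field_simp
      linarith
    rw [hprop, hGN]
    linarith

/-! ### Size of the iterates of a balanced integer -/

/-- Up to the critical time the predicted size of the iterate is at least `1`. -/
theorem one_le_sqrt_three_div_two_pow_mul {k m : ℕ} (hm : 0 < m)
    (hk : (k : ℝ) ≤ Real.logb 2 m / (1 - Real.logb 2 (Real.sqrt 3))) :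
    1 ≤ (Real.sqrt 3 / 2) ^ k * (m : ℝ) := by
  have hm0 : (0 : ℝ) < m := by exact_mod_cast hm
  have hq1 := sqrt_three_div_two_lt_one.le
  have h1 : (k : ℝ) ≤ criticalTime * Real.logb 2 m := by
    rw [criticalTime, one_div_mul_eq_div]; exact hk
  have h2 : (m : ℝ)⁻¹ ≤ (Real.sqrt 3 / 2) ^ k := by
    calc (m : ℝ)⁻¹ = (1 / 2) ^ Real.logb 2 m := by
          rw [one_div, Real.inv_rpow (by norm_num),
            Real.rpow_logb (by norm_num) (by norm_num) hm0]
      _ = (Real.sqrt 3 / 2) ^ (criticalTime * Real.logb 2 m) := by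
          rw [Real.rpow_mul (by positivity), sqrt_three_div_two_rpow_criticalTime]
      _ ≤ (Real.sqrt 3 / 2) ^ (k : ℝ) :=
          Real.rpow_le_rpow_of_exponent_ge (by positivity) hq1 h1
      _ = _ := Real.rpow_natCast _ _
  calc (1 : ℝ) = (m : ℝ)⁻¹ * m := (inv_mul_cancel₀ hm0.ne').symm
    _ ≤ _ := by gcongr

/-- The factor `m ^ ε` absorbs the error factors. In the upper bound the additive error is absorbed
too, since the predicted size is at least `1`. -/
theorem Balanced.iterate_bounds {ε a : ℝ} {k m : ℕ} (ha : 0 ≤ a) (hm : 0 < m)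
    (hb : Balanced a k m) (hk : (k : ℝ) ≤ Real.logb 2 m / (1 - Real.logb 2 (Real.sqrt 3)))
    (hε : 5 * (3 : ℝ) ^ (2 * a) ≤ (m : ℝ) ^ ε) :
    (Real.sqrt 3 / 2) ^ k * (m : ℝ) ^ (1 - ε) ≤ ((T^[k] m : ℕ) : ℝ) ∧
      ((T^[k] m : ℕ) : ℝ) ≤ (Real.sqrt 3 / 2) ^ k * (m : ℝ) ^ (1 + ε) ∧
      remainder k m * (3 : ℝ) ^ ((k : ℝ) / 2) * (m : ℝ) ^ (-ε) < 1 := by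
  have hm0 : (0 : ℝ) < m := by exact_mod_cast hm
  have hme : (0 : ℝ) < (m : ℝ) ^ ε := by positivity
  have h3 : (3 : ℝ) ^ a ≤ 3 ^ (2 * a) :=
    Real.rpow_le_rpow_of_exponent_le (by norm_num) (by linarith)
  have h3a : (0 : ℝ) < 3 ^ (2 * a) := by positivity
  have hone := one_le_sqrt_three_div_two_pow_mul hm hk
  refine ⟨?_, ?_, ?_⟩
  · rw [Real.rpow_sub hm0, Real.rpow_one, ← mul_div_assoc, div_le_iff₀ hme]
    refine hb.le_iterate.trans ?_
    gcongr
    linarith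
  · rw [Real.rpow_add hm0, Real.rpow_one, ← mul_assoc]
    calc ((T^[k] m : ℕ) : ℝ) ≤ (Real.sqrt 3 / 2) ^ k * m * 3 ^ a + 4 * 3 ^ (2 * a) :=
          hb.iterate_le
      _ ≤ (Real.sqrt 3 / 2) ^ k * m * 3 ^ (2 * a) +
          ((Real.sqrt 3 / 2) ^ k * m) * (4 * 3 ^ (2 * a)) := by
          gcongr ?_ + ?_
          · gcongr
          exact le_mul_of_one_le_left (by positivity) hone
      _ = (Real.sqrt 3 / 2) ^ k * m * (5 * 3 ^ (2 * a)) := by ring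
      _ ≤ _ := by gcongr
  · rw [← sqrt_three_pow, Real.rpow_neg hm0.le, ← div_eq_mul_inv, div_lt_one hme]
    exact hb.remainder_mul_le.trans_lt (by linarith)

end ThreeXPlusOne

open ThreeXPlusOne in
theorem mainTheorem1 (ε : ℝ) (hε : 0 < ε) :
    ThreeXPlusOne.HasNaturalDensityOne
      {m : ℕ | 0 < m ∧ ∀ k : ℕ, (k : ℝ) ≤ Real.logb 2 m / (1 - Real.logb 2 (Real.sqrt 3)) →
        (Real.sqrt 3 / 2) ^ k * (m : ℝ) ^ (1 - ε) ≤ ((ThreeXPlusOne.T^[k] m : ℕ) : ℝ) ∧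
        ((ThreeXPlusOne.T^[k] m : ℕ) : ℝ) ≤ (Real.sqrt 3 / 2) ^ k * (m : ℝ) ^ (1 + ε)} ∧
    ThreeXPlusOne.HasPolynomiallyFastDensityOne
      {m : ℕ | 0 < m ∧ ∀ k : ℕ, (k : ℝ) ≤ Real.logb 2 m / (1 - Real.logb 2 (Real.sqrt 3)) →
        (Real.sqrt 3 / 2) ^ k * (m : ℝ) ^ (1 - ε) ≤ ((ThreeXPlusOne.T^[k] m : ℕ) : ℝ) ∧
        ((ThreeXPlusOne.T^[k] m : ℕ) : ℝ) ≤ (Real.sqrt 3 / 2) ^ k * (m : ℝ) ^ (1 + ε) ∧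
        ThreeXPlusOne.remainder k m * (3 : ℝ) ^ ((k : ℝ) / 2) * (m : ℝ) ^ (-ε) < 1} := by
  have hpoly : HasPolynomiallyFastDensityOne
      {m : ℕ | 0 < m ∧ ∀ k : ℕ, (k : ℝ) ≤ Real.logb 2 m / (1 - Real.logb 2 (Real.sqrt 3)) →
        (Real.sqrt 3 / 2) ^ k * (m : ℝ) ^ (1 - ε) ≤ ((T^[k] m : ℕ) : ℝ) ∧
        ((T^[k] m : ℕ) : ℝ) ≤ (Real.sqrt 3 / 2) ^ k * (m : ℝ) ^ (1 + ε) ∧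
        remainder k m * (3 : ℝ) ^ ((k : ℝ) / 2) * (m : ℝ) ^ (-ε) < 1} := by
    refine hasPolynomiallyFastDensityOne_of_balanced (δ := ε / 16) (by positivity) ⌈12 / ε⌉₊ ?_
    intro n m hn hlt hsq hb
    have hm : 0 < m := by
      rcases Nat.eq_zero_or_pos m with h0 | h0
      · subst h0; simp at hsq
      · exact h0
    have hm0 : (0 : ℝ) < m := by exact_mod_cast hm
    have hn' : 12 ≤ ε * n := by
      have := (Nat.le_ceil (12 / ε)).trans (Nat.cast_le.mpr hn)
      rw [div_le_iff₀ hε] at this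
      linarith
    -- `5 ≤ 2 ^ (ε * n / 4)` and `3 ^ (2 * (ε / 16 * n)) ≤ 2 ^ (ε * n / 4)`, while `2 ^ (n / 2) ≤ m`
    have hpow : 5 * (3 : ℝ) ^ (2 * (ε / 16 * n)) ≤ (m : ℝ) ^ ε := by
      have h5 : (5 : ℝ) ≤ 2 ^ (ε * n / 4) := by
        calc (5 : ℝ) ≤ 2 ^ (3 : ℝ) := by norm_num
          _ ≤ _ := Real.rpow_le_rpow_of_exponent_le (by norm_num) (by linarith)
      have h3 : (3 : ℝ) ^ (2 * (ε / 16 * n)) ≤ 2 ^ (ε * n / 4) := by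
        calc (3 : ℝ) ^ (2 * (ε / 16 * n)) ≤ (2 ^ (2 : ℝ)) ^ (2 * (ε / 16 * n)) := by
              gcongr; norm_num
          _ = _ := by rw [← Real.rpow_mul (by norm_num)]; congr 1; ring
      have hsq' : (2 : ℝ) ^ (n : ℝ) ≤ (m : ℝ) ^ (2 : ℝ) := by
        rw [Real.rpow_natCast, Real.rpow_two]; exact_mod_cast hsq
      calc 5 * (3 : ℝ) ^ (2 * (ε / 16 * n)) ≤ 2 ^ (ε * n / 4) * 2 ^ (ε * n / 4) := by gcongr
        _ = (2 ^ (n : ℝ)) ^ (ε / 2) := by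
            rw [← Real.rpow_add (by norm_num), ← Real.rpow_mul (by norm_num)]; congr 1; ring
        _ ≤ ((m : ℝ) ^ (2 : ℝ)) ^ (ε / 2) := by gcongr
        _ = (m : ℝ) ^ ε := by rw [← Real.rpow_mul hm0.le]; congr 1; ring
    refine ⟨hm, fun k hk => Balanced.iterate_bounds (a := ε / 16 * n) (by positivity) hm
      (hb.mono le_rfl (Nat.le_floor ?_)) hk hpow⟩
    refine hk.trans ?_
    rw [criticalTime, one_div_mul_eq_div]
    have hc := one_sub_logb_sqrt_three_pos
    gcongr
    rw [Real.logb_le_iff_le_rpow (by norm_num) hm0, Real.rpow_natCast]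
    exact_mod_cast hlt.le
  refine ⟨HasPolynomiallyFastDensityOne.hasNaturalDensityOne (hpoly.mono ?_), hpoly⟩
  exact fun m hm => ⟨hm.1, fun k hk => ⟨(hm.2 k hk).1, (hm.2 k hk).2.1⟩⟩
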